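/- Let $E$ be a Dedekind complete (real) Riesz space with universal completion $E^u$, and let $e$ be a weak order unit of $E$. A *conditional expectation operator* on $E$ is a positive order continuous linear projection $S:E\to E$ whose range $R(S)$ is a Dedekind complete Riesz subspace of $E$ and which maps weak order units to weak order units. Let $T$ be a conditional expectation operator on $E$ with $Te=e$, and suppose that $E$ is $T$-universally complete, $E=L^1(T)$: every upwards directed net $(f_\lambda)$ in $E_+$ for which $(Tf_\lambda)$ is order bounded in $E^u$ is order convergent in $E$. Let $U,V$ be conditional expectation operators on $E$ compatible with $T$, that is, $TU=T=UT$ and $TV=T=VT$. Products are taken in the $f$-algebra structure whose unit is $e$. For a conditional expectation operator $S$ compatible with $T$ let $\mathcal B(S)$ be the set of band projections $P$ on $E$ with $Pe\in R(S)$, and put $$\alpha_T(U,V)=\sup\{\,|TPQe-TPe\cdot TQe| \;:\; P\in\mathcal B(U),\ Q\in\mathcal B(V)\,\}.$$ Let $L^\infty(T)=\{f\in E : |f|\le h \text{ for some } h\in R(T)_+\}$, and put $$\|f\|_{T,1}=T|f|\quad (f\in E),\qquad \|f\|_{T,\infty}=\inf\{h\in R(T)_+ : |f|\le h\}\quad (f\in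 L^\infty(T)).$$ Then for every $g\in L^\infty(T)$ $$\|UVg-Tg\|_{T,1}\;\le\;4\,\alpha_T(U,V)\cdot\|g\|_{T,\infty}.$$ -/

import Mathlib

namespace RieszMixing

/-- Dedekind completeness: every non-empty set that is bounded above has a supremum. -/
def DedekindComplete (α : Type*) [Preorder α] : Prop :=
  ∀ s : Set α, s.Nonempty → BddAbove s → ∃ a, IsLUB s a

section UniversalCompletion

variable {E F : Type*}
  [AddCommGroup E] [Lattice E] [Module ℝ E]
  [AddCommGroup F] [Lattice F] [Module ℝ F]

/-- A Riesz space is universally complete if it is Dedekind complete and every (non-empty) set of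
mutually disjoint positive elements has a supremum. -/
structure IsUniversallyComplete (F : Type*) [AddCommGroup F] [Lattice F] : Prop where
  dedekindComplete : DedekindComplete F
  lateral : ∀ s : Set F, s.Nonempty → (∀ x ∈ s, 0 ≤ x) →
    (∀ x ∈ s, ∀ y ∈ s, x ≠ y → x ⊓ y = 0) → ∃ a, IsLUB s a

/-- `ι : E → F` exhibits `F` as a universal completion of `E`: `F` is universally complete and `ι`
identifies `E` with an order dense Riesz subspace of `F`. -/
structure IsUniversalCompletion (ι : E →ₗ[ℝ] F) : Prop where
  universallyComplete : IsUniversallyComplete F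
  injective : Function.Injective ι
  map_sup : ∀ f g : E, ι (f ⊔ g) = ι f ⊔ ι g
  orderDense : ∀ x : F, 0 < x → ∃ f : E, 0 < ι f ∧ ι f ≤ x

/-- `E` is `T`-universally complete, i.e. `E = L¹(T)`: every upwards directed family `D` in the
positive cone of `E` for which `T D` is order bounded in the universal completion (`ι : E → F`)
is order convergent in `E`; for an upwards directed family this means that it has a supremum. -/
def IsTUniversallyComplete (T : E →ₗ[ℝ] E) (ι : E →ₗ[ℝ] F) : Prop :=
  ∀ D : Set E, D.Nonempty → DirectedOn (· ≤ ·) D → (∀ f ∈ D, 0 ≤ f) →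
    BddAbove ((fun f => ι (T f)) '' D) → ∃ a, IsLUB D a

end UniversalCompletion

section Operators

variable {E : Type*} [AddCommGroup E] [Lattice E] [Module ℝ E]

/-- Weak order units: positive elements disjoint from no non-zero element. -/
def IsWeakOrderUnit (e : E) : Prop :=
  0 ≤ e ∧ ∀ f : E, |f| ⊓ e = 0 → f = 0

/-- Conditional expectation operators: positive order continuous linear projections whose range is
a Dedekind complete Riesz subspace and which map weak order units to weak order units. -/
structure IsCondExpOperator (T : E →ₗ[ℝ] E) : Prop where
  nonneg : ∀ f, 0 ≤ f → 0 ≤ T f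
  orderContinuous : ∀ D : Set E, D.Nonempty → DirectedOn (· ≥ ·) D → IsGLB D 0 →
    IsGLB (T '' D) 0
  idem : ∀ f, T (T f) = T f
  sup_mem : ∀ f ∈ LinearMap.range T, ∀ g ∈ LinearMap.range T, f ⊔ g ∈ LinearMap.range T
  range_dedekindComplete : DedekindComplete (LinearMap.range T)
  map_weakOrderUnit : ∀ e, IsWeakOrderUnit e → IsWeakOrderUnit (T e)

/-- `U` is compatible with `T`: `TU = T = UT`. -/
def Compatible (U T : E →ₗ[ℝ] E) : Prop :=
  T ∘ₗ U = T ∧ U ∘ₗ T = T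

/-- Band projections: linear projections `P` with `0 ≤ P ≤ I`. -/
structure IsBandProjection (P : E →ₗ[ℝ] E) : Prop where
  idem : ∀ f, P (P f) = P f
  nonneg : ∀ f, 0 ≤ f → 0 ≤ P f
  le_self : ∀ f, 0 ≤ f → P f ≤ f

/-- `𝓑(U)`: the band projections `P` with `P e` in the range of `U`. -/
def bandProjections (e : E) (U : E →ₗ[ℝ] E) : Set (E →ₗ[ℝ] E) :=
  {P | IsBandProjection P ∧ P e ∈ LinearMap.range U}

/-- `L^∞(T)`: the elements of `E = L¹(T)` bounded by a positive element of the range of `T`. -/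
def LInfty (T : E →ₗ[ℝ] E) : Set E :=
  {f | ∃ g ∈ LinearMap.range T, 0 ≤ g ∧ |f| ≤ g}

/-- `‖f‖_{T,1} = T|f|`. -/
def norm1 (T : E →ₗ[ℝ] E) (f : E) : E := T |f|

theorem isBandProjection_zero : IsBandProjection (0 : E →ₗ[ℝ] E) :=
  ⟨fun _ => rfl, fun _ _ => le_refl _, fun _ h => h⟩

end Operators

section Complete

variable {E : Type*} [AddCommGroup E] [ConditionallyCompleteLattice E] [Module ℝ E]

/-- The vector norm `‖f‖_{T,∞} = inf {g ∈ R(T)₊ | |f| ≤ g}`. -/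
noncomputable def normInfty (T : E →ₗ[ℝ] E) (f : E) : E :=
  sInf {g | g ∈ LinearMap.range T ∧ 0 ≤ g ∧ |f| ≤ g}

/-- The product `f · g` of two positive elements in the `f`-algebra structure with unit `e`.
Multiplication by a multiple `t • P e` of a component of `e` (`P` a band projection) is the operator
`t • P`, and a positive `f` is the supremum of the `t • P e` below it, so that
`f · g = sup {t • P g | t ≥ 0, P a band projection, t • P e ≤ f}`. -/
noncomputable def posMul (e f g : E) : E :=
  sSup {h | ∃ (t : ℝ) (P : E →ₗ[ℝ] E), 0 ≤ t ∧ IsBandProjection P ∧ t • P e ≤ f ∧ h = t • P g}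

/-- The product in the `f`-algebra structure with unit `e`, extended from positive elements by
`f · g = f⁺ · g⁺ + f⁻ · g⁻ - f⁺ · g⁻ - f⁻ · g⁺`. -/
noncomputable def unitMul (e f g : E) : E :=
  posMul e f⁺ g⁺ + posMul e f⁻ g⁻ - posMul e f⁺ g⁻ - posMul e f⁻ g⁺

/-- The set of all `|TPQe - TPe · TQe|` with `P ∈ 𝓑(U)` and `Q ∈ 𝓑(V)`. -/
def mixingSet (e : E) (T U V : E →ₗ[ℝ] E) : Set E :=
  {h | ∃ P ∈ bandProjections e U, ∃ Q ∈ bandProjections e V,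
    h = |T (P (Q e)) - unitMul e (T (P e)) (T (Q e))|}

/-- The `T`-conditional strong mixing coefficient `α_T(U,V)`. -/
noncomputable def strongMixing (e : E) (T U V : E →ₗ[ℝ] E) : E :=
  sSup (mixingSet e T U V)

/-- The infimum defining `‖f‖_{T,∞}` exists for `f ∈ L^∞(T)`. -/
theorem isGLB_normInfty {T : E →ₗ[ℝ] E} {f : E} (hf : f ∈ LInfty T) :
    IsGLB {g | g ∈ LinearMap.range T ∧ 0 ≤ g ∧ |f| ≤ g} (normInfty T f) := by
  obtain ⟨g, hg, hg0, hfg⟩ := hf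
  exact isGLB_csInf ⟨g, hg, hg0, hfg⟩ ⟨0, fun x hx => hx.2.1⟩

end Complete

section WellDefined

variable {E : Type*} [AddCommGroup E] [ConditionallyCompleteLattice E] [IsOrderedAddMonoid E]
  [Module ℝ E] [IsOrderedModule ℝ E]

/-- A multiple `t • P` of a band projection with `t • P e ≤ e` is dominated by the identity. -/
theorem smul_bandProjection_le {e g : E} {t : ℝ} {P : E →ₗ[ℝ] E} (he : IsWeakOrderUnit e)
    (hP : IsBandProjection P) (hte : t • P e ≤ e) (hg : 0 ≤ g) : t • P g ≤ g := by
  rcases le_or_gt t 1 with h1 | h1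
  · calc t • P g ≤ (1 : ℝ) • P g := smul_le_smul_of_nonneg_right h1 (hP.nonneg g hg)
      _ = P g := one_smul _ _
      _ ≤ g := hP.le_self g hg
  · have mono : ∀ x y : E, x ≤ y → P x ≤ P y := fun x y hxy => by
      have := hP.nonneg (y - x) (sub_nonneg.2 hxy)
      rw [map_sub] at this
      exact sub_nonneg.1 this
    have h2 : t • P e ≤ P e := by
      have := mono _ _ hte
      rwa [map_smul, hP.idem] at this
    have h3 : (t - 1) • P e ≤ 0 := by
      rw [sub_smul, one_smul]
      exact sub_nonpos.2 h2
    have h4 : P e ≤ 0 := by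
      have := smul_le_smul_of_nonneg_left h3 (inv_nonneg.2 (sub_nonneg.2 h1.le))
      rwa [smul_zero, smul_smul, inv_mul_cancel₀ (sub_ne_zero.2 h1.ne'), one_smul] at this
    have hPg := hP.nonneg g hg
    have hx0 : 0 ≤ P g ⊓ e := le_inf hPg he.1
    have h5 : P g ⊓ e ≤ P (P g ⊓ e) := by
      have := hP.le_self (P g - P g ⊓ e) (sub_nonneg.2 inf_le_left)
      rw [map_sub, hP.idem] at this
      exact (sub_le_sub_iff_left (P g)).1 this
    have h6 : P g ⊓ e = 0 :=
      le_antisymm (h5.trans ((mono _ _ inf_le_right).trans h4)) hx0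
    have h7 : P g = 0 := he.2 _ (by rw [abs_of_nonneg hPg, h6])
    rw [h7, smul_zero]
    exact hg

/-- For `0 ≤ f ≤ e` and `0 ≤ g` the supremum defining `f · g` exists, and `0 ≤ f · g ≤ g`. -/
theorem isLUB_posMul {e f g : E} (he : IsWeakOrderUnit e) (hf : 0 ≤ f) (hfe : f ≤ e)
    (hg : 0 ≤ g) :
    IsLUB {h | ∃ (t : ℝ) (P : E →ₗ[ℝ] E), 0 ≤ t ∧ IsBandProjection P ∧ t • P e ≤ f ∧
      h = t • P g} (posMul e f g) ∧ 0 ≤ posMul e f g ∧ posMul e f g ≤ g := by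
  have h0 : (0 : E) ∈ {h | ∃ (t : ℝ) (P : E →ₗ[ℝ] E), 0 ≤ t ∧ IsBandProjection P ∧
      t • P e ≤ f ∧ h = t • P g} :=
    ⟨0, 0, le_refl _, isBandProjection_zero, by simpa using hf, by simp⟩
  have hub : g ∈ upperBounds {h | ∃ (t : ℝ) (P : E →ₗ[ℝ] E), 0 ≤ t ∧ IsBandProjection P ∧
      t • P e ≤ f ∧ h = t • P g} := by
    rintro _ ⟨t, P, ht, hP, hte, rfl⟩
    exact smul_bandProjection_le he hP (hte.trans hfe) hg
  have hL := isLUB_csSup ⟨0, h0⟩ ⟨g, hub⟩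
  exact ⟨hL, hL.1 h0, hL.2 hub⟩

/-- On positive elements the product is given by the defining supremum. -/
theorem unitMul_of_nonneg {e f g : E} (he : IsWeakOrderUnit e) (hf : 0 ≤ f) (hfe : f ≤ e)
    (hg : 0 ≤ g) : unitMul e f g = posMul e f g := by
  have hz : posMul e f 0 = 0 :=
    le_antisymm (isLUB_posMul he hf hfe le_rfl).2.2 (isLUB_posMul he hf hfe le_rfl).2.1
  have hz' : posMul e 0 g = 0 := by
    refine le_antisymm ((isLUB_posMul he le_rfl he.1 hg).1.2 ?_)
      (isLUB_posMul he le_rfl he.1 hg).2.1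
    rintro _ ⟨t, P, ht, hP, hte, rfl⟩
    have h1 : ∀ n : ℕ, n • (t • P g) ≤ g := fun n => by
      have := smul_bandProjection_le (t := n * t) he hP
        (by rw [mul_smul]
            exact (smul_le_smul_of_nonneg_left hte (Nat.cast_nonneg n)).trans
              ((smul_zero _).trans_le he.1)) hg
      rwa [mul_smul, Nat.cast_smul_eq_nsmul] at this
    have hb : BddAbove (Set.range fun n : ℕ => n • (t • P g)) :=
      ⟨g, by rintro _ ⟨n, rfl⟩; exact h1 n⟩
    have hl := isLUB_csSup (Set.range_nonempty _) hb
    set s := sSup (Set.range fun n : ℕ => n • (t • P g))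
    have : s ≤ s - t • P g := hl.2 (by
      rintro _ ⟨n, rfl⟩
      have := hl.1 ⟨n + 1, rfl⟩
      simp only [succ_nsmul] at this
      exact le_sub_iff_add_le.2 this)
    have h3 := sub_le_sub_right this s
    simpa using h3
  have hz'' : posMul e 0 (0 : E) = 0 :=
    le_antisymm (isLUB_posMul he le_rfl he.1 le_rfl).2.2 (isLUB_posMul he le_rfl he.1 le_rfl).2.1
  rw [unitMul, posPart_of_nonneg hf, posPart_of_nonneg hg, negPart_of_nonneg hf,
    negPart_of_nonneg hg, hz, hz', hz'']
  simp

/-- The supremum defining `α_T(U,V)` exists, and `0 ≤ α_T(U,V) ≤ e`. -/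
theorem isLUB_strongMixing {e : E} {T U V : E →ₗ[ℝ] E} (he : IsWeakOrderUnit e)
    (hT : IsCondExpOperator T) (hTe : T e = e) :
    IsLUB (mixingSet e T U V) (strongMixing e T U V) ∧
      0 ≤ strongMixing e T U V ∧ strongMixing e T U V ≤ e := by
  have mono : ∀ x y : E, x ≤ y → T x ≤ T y := fun x y hxy => by
    have := hT.nonneg (y - x) (sub_nonneg.2 hxy)
    rw [map_sub] at this
    exact sub_nonneg.1 this
  have hne : |T ((0 : E →ₗ[ℝ] E) ((0 : E →ₗ[ℝ] E) e)) -
      unitMul e (T ((0 : E →ₗ[ℝ] E) e)) (T ((0 : E →ₗ[ℝ] E) e))| ∈ mixingSet e T U V :=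
    ⟨0, ⟨isBandProjection_zero, zero_mem _⟩, 0, ⟨isBandProjection_zero, zero_mem _⟩, rfl⟩
  have hub : e ∈ upperBounds (mixingSet e T U V) := by
    rintro _ ⟨P, ⟨hP, -⟩, Q, ⟨hQ, -⟩, rfl⟩
    have hQ0 := hQ.nonneg e he.1
    have hP1 : T (P e) ≤ e := (mono _ _ (hP.le_self e he.1)).trans_eq hTe
    have hQ1 : T (Q e) ≤ e := (mono _ _ (hQ.le_self e he.1)).trans_eq hTe
    have hP0 := hT.nonneg _ (hP.nonneg e he.1)
    have hTQ0 := hT.nonneg _ hQ0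
    have hm := isLUB_posMul he hP0 hP1 hTQ0
    rw [unitMul_of_nonneg he hP0 hP1 hTQ0]
    have h1 : T (P (Q e)) ≤ e := (mono _ _ (hP.le_self _ hQ0)).trans hQ1
    have h2 : 0 ≤ T (P (Q e)) := hT.nonneg _ (hP.nonneg _ hQ0)
    refine sup_le ((sub_le_self _ hm.2.1).trans h1) ?_
    rw [neg_sub]
    exact (sub_le_self _ h2).trans (hm.2.2.trans hQ1)
  have hL := isLUB_csSup ⟨_, hne⟩ ⟨e, hub⟩
  exact ⟨hL, (abs_nonneg _).trans (hL.1 hne), hL.2 hub⟩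

end WellDefined

end RieszMixing

open RieszMixing

set_option linter.unusedSectionVars false

-- Put f = UVg - Tg and N = ‖g‖_{T,∞}, and let P project onto the band of f⁺. As f lies in R(U), P
-- is in 𝓑(U). The symmetry S = 2P - I commutes with U and Sf = |f|, so TU = T turns T|f| into
-- φ(Vg), where φ(h) = TSVh - TSTh (`covarianceOp`).
--
-- On components of e in R(V), φ is integration against w = VSe - TSe. Since |Vg| ≤ N, this gives
-- φ(Vg) ≤ φ(RN) with R = 2Q - I, where Q in 𝓑(V) projects onto the band of w⁺
-- (`covarianceOp_le_reflection`). At e the identity parts of both symmetries cancel and φ(Re) =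
-- 4(TPQe - TPTQe). By the averaging property TPTQe = TPe · TQe (`posMul_condExp`), so φ(Re) ≤ 4α.
-- Finally φR commutes at e with the projections in 𝓑(T), which carries the bound from e to N in
-- R(T) (`IsRegSeqContinuous.apply_le_smul_posMul`).
--
-- The product enters only through its defining supremum. Inequalities between order continuous
-- operators on R(W)₊ are checked on components of e in R(W) (`le_of_le_components`), by Freudenthal
-- approximation and truncation. Multiplication by 0 ≤ x ≤ e is replaced by `simpleApprox`, a
-- positive combination of band projections whose value at e is within e/(n+1) of x.

namespace RieszMixing

-- The Archimedean property, in the form used for limits.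

section Archimedean

variable {E : Type*} [AddCommGroup E] [ConditionallyCompleteLattice E] [IsOrderedAddMonoid E]
  [Module ℝ E] [IsOrderedModule ℝ E]

theorem smul_inf_of_nonneg {t : ℝ} (ht : 0 ≤ t) (a b : E) : t • (a ⊓ b) = t • a ⊓ t • b := by
  rcases ht.eq_or_lt with rfl | h
  · simp
  · exact (OrderIso.smulRight (β := E) h).map_inf a b

/-- A Dedekind complete Riesz space is Archimedean. -/
theorem nonpos_of_nsmul_le {d z : E} (h : ∀ n : ℕ, n • d ≤ z) : d ≤ 0 := by
  have hb : BddAbove (Set.range fun n : ℕ => n • d) := ⟨z, by rintro _ ⟨n, rfl⟩; exact h n⟩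
  have hl := isLUB_csSup (Set.range_nonempty _) hb
  set s := sSup (Set.range fun n : ℕ => n • d)
  have : s ≤ s - d := hl.2 (by
    rintro _ ⟨n, rfl⟩
    have := hl.1 ⟨n + 1, rfl⟩
    simp only [succ_nsmul] at this
    exact le_sub_iff_add_le.2 this)
  have h3 := sub_le_sub_right this s
  simpa using h3

theorem le_of_forall_le_add_inv_smul {x y z : E}
    (h : ∀ n : ℕ, x ≤ y + ((n + 1 : ℝ)⁻¹) • z) : x ≤ y := by
  -- The bound is `z ⊔ 0` because the multiple `n = 0` needs a nonnegative one.
  refine sub_nonpos.1 (nonpos_of_nsmul_le (z := z ⊔ 0) fun n => ?_)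
  cases n with
  | zero => simp
  | succ n =>
    have h1 : x - y ≤ ((n + 1 : ℝ)⁻¹) • z := sub_le_iff_le_add'.2 (h n)
    have h2 := smul_le_smul_of_nonneg_left h1 (a := (n + 1 : ℝ)) (by positivity)
    rw [smul_smul, mul_inv_cancel₀ (by positivity), one_smul] at h2
    rw [← Nat.cast_smul_eq_nsmul ℝ]
    push_cast
    exact h2.trans le_sup_left

end Archimedean

-- Construction of principal band projections.

section BandProjections

variable {E : Type*} [AddCommGroup E] [ConditionallyCompleteLattice E] [IsOrderedAddMonoid E]
  [Module ℝ E] [IsOrderedModule ℝ E]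

/-- For `f, u ≥ 0`, the component of `f` in the band generated by `u`. -/
noncomputable def bandPart (u f : E) : E := sSup (Set.range fun c : NNReal => f ⊓ (c : ℝ) • u)

theorem isLUB_bandPart (u f : E) :
    IsLUB (Set.range fun c : NNReal => f ⊓ (c : ℝ) • u) (bandPart u f) :=
  isLUB_csSup (Set.range_nonempty _) ⟨f, by rintro _ ⟨c, rfl⟩; exact inf_le_left⟩

theorem inf_smul_le_bandPart (u f : E) (c : NNReal) : f ⊓ (c : ℝ) • u ≤ bandPart u f :=
  (isLUB_bandPart u f).1 ⟨c, rfl⟩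

theorem bandPart_le {u f b : E} (h : ∀ c : NNReal, f ⊓ (c : ℝ) • u ≤ b) : bandPart u f ≤ b :=
  (isLUB_bandPart u f).2 (by rintro _ ⟨c, rfl⟩; exact h c)

theorem bandPart_le_self (u f : E) : bandPart u f ≤ f := bandPart_le fun _ => inf_le_left

theorem bandPart_nonneg {u f : E} (hf : 0 ≤ f) : 0 ≤ bandPart u f := by
  have := inf_smul_le_bandPart u f 0
  simpa [hf] using this

/-- Truncation at a fixed `c • u` is subadditive, which gives `≤`. For `≥`, truncations at `c • u`
and `d • u` sum to at most the truncation of `f + g` at `(c + d) • u`. -/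
theorem bandPart_add {u f g : E} (hu : 0 ≤ u) (hf : 0 ≤ f) (hg : 0 ≤ g) :
    bandPart u (f + g) = bandPart u f + bandPart u g := by
  apply le_antisymm
  · refine bandPart_le fun c => ?_
    have hc : 0 ≤ (c : ℝ) • u := smul_nonneg c.2 hu
    refine le_trans ?_ (add_le_add (inf_smul_le_bandPart u f c) (inf_smul_le_bandPart u g c))
    rw [inf_add, add_inf, add_inf]
    refine le_inf (le_inf inf_le_left (inf_le_right.trans ?_))
      (le_inf (inf_le_right.trans ?_) (inf_le_right.trans ?_))
    · exact le_add_of_nonneg_left hf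
    · exact le_add_of_nonneg_right hg
    · exact le_add_of_nonneg_right hc
  · rw [← le_sub_iff_add_le]
    refine bandPart_le fun c => ?_
    rw [le_sub_comm]
    refine bandPart_le fun d => ?_
    rw [le_sub_iff_add_le]
    refine le_trans (le_inf ?_ ?_) (inf_smul_le_bandPart u (f + g) (c + d))
    · rw [add_comm f g]
      exact add_le_add inf_le_left inf_le_left
    · push_cast
      rw [add_smul, add_comm ((c : ℝ) • u)]
      exact add_le_add inf_le_right inf_le_right

theorem smul_bandPart_le {u f : E} {t : ℝ} (ht : 0 < t) :
    t • bandPart u f ≤ bandPart u (t • f) := by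
  have : bandPart u f ≤ t⁻¹ • bandPart u (t • f) := bandPart_le fun c => by
    have h := inf_smul_le_bandPart u (t • f) (t.toNNReal * c)
    have h' := smul_le_smul_of_nonneg_left h (inv_nonneg.2 ht.le)
    refine le_trans (le_of_eq ?_) h'
    rw [NNReal.coe_mul, Real.coe_toNNReal _ ht.le, mul_smul, ← smul_inf_of_nonneg ht.le, smul_smul,
      inv_mul_cancel₀ ht.ne', one_smul]
  have h := smul_le_smul_of_nonneg_left this ht.le
  rwa [smul_smul, mul_inv_cancel₀ ht.ne', one_smul] at h

theorem bandPart_smul {u f : E} {t : ℝ} (ht : 0 < t) :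
    bandPart u (t • f) = t • bandPart u f := by
  refine le_antisymm ?_ (smul_bandPart_le ht)
  have h := smul_bandPart_le (u := u) (f := t • f) (inv_pos.2 ht)
  rw [smul_smul, inv_mul_cancel₀ ht.ne', one_smul] at h
  have h' := smul_le_smul_of_nonneg_left h ht.le
  rwa [smul_smul, mul_inv_cancel₀ ht.ne', one_smul] at h'

theorem bandPart_zero (u : E) : bandPart u (0 : E) = 0 :=
  le_antisymm (bandPart_le_self u 0) (bandPart_nonneg le_rfl)

theorem bandPart_bandPart (u f : E) : bandPart u (bandPart u f) = bandPart u f :=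
  le_antisymm (bandPart_le_self _ _) <| bandPart_le fun c =>
    (le_inf (inf_smul_le_bandPart u f c) inf_le_right).trans (inf_smul_le_bandPart u _ c)

theorem sub_bandPart_inf {u f : E} (hu : 0 ≤ u) : (f - bandPart u f) ⊓ u = 0 := by
  refine le_antisymm ?_ (le_inf (sub_nonneg.2 (bandPart_le_self u f)) hu)
  -- Adding this infimum to a truncation at `c • u` stays below the truncation at `(c + 1) • u`, so
  -- the supremum may be lowered by it.
  have : bandPart u f ≤ bandPart u f - (f - bandPart u f) ⊓ u := bandPart_le fun c => by
    rw [le_sub_iff_add_le]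
    refine le_trans (le_inf ?_ ?_) (inf_smul_le_bandPart u f (c + 1))
    · calc _ ≤ bandPart u f + (f - bandPart u f) :=
            add_le_add (inf_smul_le_bandPart u f c) inf_le_left
        _ = f := by abel
    · push_cast
      rw [add_smul, one_smul]
      exact add_le_add inf_le_right inf_le_right
  have h := sub_le_sub_right this (bandPart u f)
  simpa using h

/-- The function `f ↦ p f⁺ - p f⁻` is additive if `p` is additive on the positive cone. -/
theorem add_of_add_on_cone {p : E → E} (hp : ∀ f g, 0 ≤ f → 0 ≤ g → p (f + g) = p f + p g)
    (f g : E) : p (f + g)⁺ - p (f + g)⁻ = (p f⁺ - p f⁻) + (p g⁺ - p g⁻) := by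
  have h : (f + g)⁺ + (f⁻ + g⁻) = (f + g)⁻ + (f⁺ + g⁺) := by
    have h1 := posPart_sub_negPart (f + g)
    have h2 := posPart_sub_negPart f
    have h3 := posPart_sub_negPart g
    have h4 : (f + g)⁺ - (f + g)⁻ = (f⁺ - f⁻) + (g⁺ - g⁻) := by rw [h1, h2, h3]
    rw [sub_eq_iff_eq_add] at h4
    rw [h4]
    abel
  have h' := congrArg p h
  rw [hp _ _ (posPart_nonneg _) (add_nonneg (negPart_nonneg _) (negPart_nonneg _)),
    hp _ _ (negPart_nonneg _) (negPart_nonneg _),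
    hp _ _ (negPart_nonneg _) (add_nonneg (posPart_nonneg _) (posPart_nonneg _)),
    hp _ _ (posPart_nonneg _) (posPart_nonneg _)] at h'
  rw [← eq_sub_iff_add_eq] at h'
  rw [h']
  abel

theorem posPart_smul_of_nonneg {t : ℝ} (ht : 0 ≤ t) (f : E) : (t • f)⁺ = t • f⁺ := by
  rcases ht.eq_or_lt with rfl | h
  · simp
  · have := (OrderIso.smulRight (β := E) h).map_sup f 0
    rw [OrderIso.smulRight_apply, OrderIso.smulRight_apply, OrderIso.smulRight_apply,
      smul_zero] at this
    exact this.symm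

theorem negPart_smul_of_nonneg {t : ℝ} (ht : 0 ≤ t) (f : E) : (t • f)⁻ = t • f⁻ := by
  rw [← posPart_neg, ← posPart_neg, ← smul_neg, posPart_smul_of_nonneg ht]

/-- The projection onto the band generated by `u ≥ 0`. -/
noncomputable def bandProj (u : E) (hu : 0 ≤ u) : E →ₗ[ℝ] E where
  toFun f := bandPart u f⁺ - bandPart u f⁻
  map_add' := add_of_add_on_cone fun _ _ => bandPart_add hu
  map_smul' t f := by
    have key : ∀ s : ℝ, 0 ≤ s → ∀ f : E, bandPart u (s • f)⁺ - bandPart u (s • f)⁻ =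
        s • (bandPart u f⁺ - bandPart u f⁻) := fun s hs f => by
      rcases hs.eq_or_lt with rfl | h
      · simp [bandPart_zero]
      · rw [posPart_smul_of_nonneg hs, negPart_smul_of_nonneg hs, bandPart_smul h, bandPart_smul h,
          smul_sub]
    rcases le_total 0 t with h | h
    · exact key t h f
    · have h1 := key (-t) (neg_nonneg.2 h) (-f)
      rw [neg_smul_neg, posPart_neg, negPart_neg] at h1
      rw [h1, RingHom.id_apply, neg_smul, ← smul_neg, neg_sub]

theorem bandProj_apply {u f : E} (hu : 0 ≤ u) (hf : 0 ≤ f) : bandProj u hu f = bandPart u f := by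
  change bandPart u f⁺ - bandPart u f⁻ = _
  rw [posPart_of_nonneg hf, negPart_of_nonneg hf, bandPart_zero, sub_zero]

theorem isBandProjection_bandProj {u : E} (hu : 0 ≤ u) : IsBandProjection (bandProj u hu) := by
  have h0 : ∀ f, 0 ≤ f → 0 ≤ bandProj u hu f := fun f hf => by
    rw [bandProj_apply hu hf]; exact bandPart_nonneg hf
  have h1 : ∀ f, 0 ≤ f → bandProj u hu (bandProj u hu f) = bandProj u hu f := fun f hf => by
    rw [bandProj_apply hu (h0 f hf), bandProj_apply hu hf, bandPart_bandPart]
  refine ⟨fun f => ?_, h0, fun f hf => by rw [bandProj_apply hu hf]; exact bandPart_le_self u f⟩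
  rw [← posPart_sub_negPart f]
  simp only [map_sub]
  rw [h1 _ (posPart_nonneg _), h1 _ (negPart_nonneg _)]

end BandProjections

-- Commutation and lattice properties of band projections.

section BandProjectionAlgebra

variable {E : Type*} [AddCommGroup E] [Lattice E] [IsOrderedAddMonoid E]
  [Module ℝ E]

theorem map_mono_of_nonneg {A : E →ₗ[ℝ] E} (hA : ∀ f, 0 ≤ f → 0 ≤ A f) {x y : E} (h : x ≤ y) :
    A x ≤ A y := by
  have := hA (y - x) (sub_nonneg.2 h)
  rw [map_sub] at this
  exact sub_nonneg.1 this

/-- Linear maps that agree on the positive cone are equal. -/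
theorem eq_of_eq_on_cone {A B : E →ₗ[ℝ] E} (h : ∀ f, 0 ≤ f → A f = B f) (f : E) : A f = B f := by
  rw [← posPart_sub_negPart f, map_sub, map_sub, h _ (posPart_nonneg _), h _ (negPart_nonneg _)]

namespace IsBandProjection

variable {P Q : E →ₗ[ℝ] E}

theorem mono (hP : IsBandProjection P) {x y : E} (h : x ≤ y) : P x ≤ P y :=
  map_mono_of_nonneg hP.nonneg h

theorem compl (hP : IsBandProjection P) : IsBandProjection (LinearMap.id - P) where
  idem f := by simp [hP.idem]
  nonneg f hf := by simpa using hP.le_self f hf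
  le_self f hf := by simpa using hP.nonneg f hf

/-- The range of a band projection is solid. -/
theorem eq_self_of_le (hP : IsBandProjection P) {x y : E} (hx : 0 ≤ x) (h : x ≤ P y) :
    P x = x := by
  refine le_antisymm (hP.le_self x hx) ?_
  have h1 := hP.le_self _ (sub_nonneg.2 h)
  rw [map_sub, hP.idem] at h1
  exact (sub_le_sub_iff_left _).1 h1

/-- By solidity `Q` preserves the range of `P` and that of its complement. Hence `P` fixes `Q (P f)`
and kills `Q (f - P f)`. -/
theorem commute (hP : IsBandProjection P) (hQ : IsBandProjection Q) (f : E) :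
    P (Q f) = Q (P f) := by
  refine eq_of_eq_on_cone (A := P ∘ₗ Q) (B := Q ∘ₗ P) (fun f hf => ?_) f
  have h1 : P (Q (P f)) = Q (P f) :=
    hP.eq_self_of_le (hQ.nonneg _ (hP.nonneg _ hf)) (hQ.le_self _ (hP.nonneg _ hf))
  have h2 : P (Q (f - P f)) = 0 := by
    have hc : 0 ≤ f - P f := sub_nonneg.2 (hP.le_self f hf)
    have := hP.compl.eq_self_of_le (x := Q (f - P f)) (y := f) (hQ.nonneg _ hc)
      (by simpa using hQ.le_self _ hc)
    simpa using this
  rw [map_sub, map_sub, sub_eq_zero] at h2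
  simp only [LinearMap.comp_apply]
  rw [h2, h1]

theorem comp (hP : IsBandProjection P) (hQ : IsBandProjection Q) : IsBandProjection (P ∘ₗ Q) where
  idem f := by
    simp only [LinearMap.comp_apply]
    rw [← hP.commute hQ, hQ.idem, hP.idem]
  nonneg f hf := hP.nonneg _ (hQ.nonneg _ hf)
  le_self f hf := (hP.le_self _ (hQ.nonneg _ hf)).trans (hQ.le_self _ hf)

theorem map_posPart (hP : IsBandProjection P) (f : E) : P f⁺ = (P f)⁺ := by
  have h0 : P f⁺ ⊓ P f⁻ = 0 := by
    refine le_antisymm ?_ (le_inf (hP.nonneg _ (posPart_nonneg _)) (hP.nonneg _ (negPart_nonneg _)))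
    rw [← posPart_inf_negPart_eq_zero f]
    exact inf_le_inf (hP.le_self _ (posPart_nonneg _)) (hP.le_self _ (negPart_nonneg _))
  have h1 : P f = P f⁺ - P f⁻ := by rw [← map_sub, posPart_sub_negPart]
  have h2 : (P f⁺ - P f⁻) ⊔ 0 = P f⁺ - P f⁺ ⊓ P f⁻ := by
    rw [sub_inf, sub_self, sup_comm]
  rw [h1, posPart_def (P f⁺ - P f⁻), h2, h0, sub_zero]

theorem map_inf (hP : IsBandProjection P) (a b : E) : P (a ⊓ b) = P a ⊓ P b := by
  have key : ∀ x y : E, x ⊓ y = x - (x - y)⁺ := fun x y => by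
    rw [posPart_def, sub_sup, sub_sub_cancel, sub_zero, inf_comm]
  rw [key, key (P a), map_sub, hP.map_posPart, map_sub]

end IsBandProjection

end BandProjectionAlgebra

end RieszMixing

namespace RieszMixing

-- Sequentially order continuous operators and their differences.

section OrderContinuity

variable {E : Type*} [AddCommGroup E] [Lattice E] [IsOrderedAddMonoid E]
  [Module ℝ E] [IsOrderedModule ℝ E]

/-- Positive operators that are continuous along sequences decreasing to `0`. -/
structure IsPosSeqContinuous (A : E →ₗ[ℝ] E) : Prop where
  nonneg : ∀ f, 0 ≤ f → 0 ≤ A f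
  cont : ∀ r : ℕ → E, Antitone r → (∀ n, 0 ≤ r n) → (∀ b, (∀ n, b ≤ r n) → b ≤ 0) →
    ∀ b, (∀ n, b ≤ A (r n)) → b ≤ 0

namespace IsPosSeqContinuous

variable {A B : E →ₗ[ℝ] E}

theorem mono (hA : IsPosSeqContinuous A) {x y : E} (h : x ≤ y) : A x ≤ A y :=
  map_mono_of_nonneg hA.nonneg h

theorem of_le_id (h0 : ∀ f, 0 ≤ f → 0 ≤ A f) (h1 : ∀ f, 0 ≤ f → A f ≤ f) :
    IsPosSeqContinuous A where
  nonneg := h0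
  cont r _ hr hinf b hb := hinf b fun n => (hb n).trans (h1 _ (hr n))

theorem comp (hA : IsPosSeqContinuous A) (hB : IsPosSeqContinuous B) :
    IsPosSeqContinuous (A ∘ₗ B) where
  nonneg f hf := hA.nonneg _ (hB.nonneg _ hf)
  cont r hr h0 hinf := hA.cont (fun n => B (r n)) (fun _ _ h => hB.mono (hr h))
    (fun n => hB.nonneg _ (h0 n)) (hB.cont r hr h0 hinf)

theorem add (hA : IsPosSeqContinuous A) (hB : IsPosSeqContinuous B) :
    IsPosSeqContinuous (A + B) where
  nonneg f hf := add_nonneg (hA.nonneg _ hf) (hB.nonneg _ hf)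
  cont r hr h0 hinf b hb := by
    -- Monotonicity at `max m n` decouples the indices, so the two infima can be taken one after the
    -- other.
    refine hA.cont r hr h0 hinf b fun m => sub_nonpos.1 (hB.cont r hr h0 hinf _ fun n => ?_)
    rw [sub_le_iff_le_add']
    exact (hb (max m n)).trans (add_le_add (hA.mono (hr (le_max_left m n)))
      (hB.mono (hr (le_max_right m n))))

theorem smul (hA : IsPosSeqContinuous A) {t : ℝ} (ht : 0 ≤ t) : IsPosSeqContinuous (t • A) where
  nonneg f hf := smul_nonneg ht (hA.nonneg _ hf)
  cont r hr h0 hinf b hb := by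
    rcases ht.eq_or_lt with rfl | ht
    · simpa using hb 0
    · have h := hA.cont r hr h0 hinf (t⁻¹ • b) fun n => by
        have h := smul_le_smul_of_nonneg_left (hb n) (inv_nonneg.2 ht.le)
        rwa [LinearMap.smul_apply, smul_smul, inv_mul_cancel₀ ht.ne', one_smul] at h
      have h' := smul_le_smul_of_nonneg_left h ht.le
      rwa [smul_smul, mul_inv_cancel₀ ht.ne', one_smul, smul_zero] at h'

end IsPosSeqContinuous

theorem IsBandProjection.isPosSeqContinuous {P : E →ₗ[ℝ] E} (hP : IsBandProjection P) :
    IsPosSeqContinuous P := .of_le_id hP.nonneg hP.le_self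

theorem IsCondExpOperator.isPosSeqContinuous {T : E →ₗ[ℝ] E} (hT : IsCondExpOperator T) :
    IsPosSeqContinuous T where
  nonneg := hT.nonneg
  cont r hr h0 hinf b hb := by
    refine (hT.orderContinuous (Set.range r) (Set.range_nonempty r) ?_
      ⟨by rintro _ ⟨n, rfl⟩; exact h0 n, fun b hb => hinf b fun n => hb ⟨n, rfl⟩⟩).2 ?_
    · rintro _ ⟨m, rfl⟩ _ ⟨n, rfl⟩
      exact ⟨_, ⟨max m n, rfl⟩, hr (le_max_left m n), hr (le_max_right m n)⟩
    · rintro _ ⟨_, ⟨n, rfl⟩, rfl⟩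
      exact hb n

/-- Differences of positive sequentially order continuous operators. -/
def IsRegSeqContinuous (A : E →ₗ[ℝ] E) : Prop :=
  ∃ B C : E →ₗ[ℝ] E, IsPosSeqContinuous B ∧ IsPosSeqContinuous C ∧ A = B - C

theorem IsPosSeqContinuous.isReg {A : E →ₗ[ℝ] E} (hA : IsPosSeqContinuous A) :
    IsRegSeqContinuous A :=
  ⟨A, 0, hA, .of_le_id (fun _ _ => le_rfl) (fun _ h => h), by simp⟩

namespace IsRegSeqContinuous

variable {A B : E →ₗ[ℝ] E}

theorem neg (hA : IsRegSeqContinuous A) : IsRegSeqContinuous (-A) := by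
  obtain ⟨A₁, A₂, h₁, h₂, rfl⟩ := hA
  exact ⟨A₂, A₁, h₂, h₁, by simp⟩

theorem add (hA : IsRegSeqContinuous A) (hB : IsRegSeqContinuous B) :
    IsRegSeqContinuous (A + B) := by
  obtain ⟨A₁, A₂, h₁, h₂, rfl⟩ := hA
  obtain ⟨B₁, B₂, k₁, k₂, rfl⟩ := hB
  exact ⟨A₁ + B₁, A₂ + B₂, h₁.add k₁, h₂.add k₂, by abel⟩

theorem sub (hA : IsRegSeqContinuous A) (hB : IsRegSeqContinuous B) :
    IsRegSeqContinuous (A - B) := by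
  rw [sub_eq_add_neg]
  exact hA.add hB.neg

theorem comp (hA : IsRegSeqContinuous A) (hB : IsRegSeqContinuous B) :
    IsRegSeqContinuous (A ∘ₗ B) := by
  obtain ⟨A₁, A₂, h₁, h₂, rfl⟩ := hA
  obtain ⟨B₁, B₂, k₁, k₂, rfl⟩ := hB
  refine ⟨A₁ ∘ₗ B₁ + A₂ ∘ₗ B₂, A₁ ∘ₗ B₂ + A₂ ∘ₗ B₁, (h₁.comp k₁).add (h₂.comp k₂),
    (h₁.comp k₂).add (h₂.comp k₁), ?_⟩
  ext f
  simp only [LinearMap.comp_apply, LinearMap.sub_apply, LinearMap.add_apply, map_sub]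
  abel

end IsRegSeqContinuous

end OrderContinuity

-- Lattice and order closure of the range of a conditional expectation.

section CondExpRange

variable {E : Type*} [AddCommGroup E] [Lattice E] [IsOrderedAddMonoid E] [Module ℝ E]

namespace IsCondExpOperator

variable {W : E →ₗ[ℝ] E}

theorem mem_range (hW : IsCondExpOperator W) {f : E} : f ∈ LinearMap.range W ↔ W f = f :=
  ⟨by rintro ⟨g, rfl⟩; exact hW.idem g, fun h => ⟨f, h⟩⟩

theorem mono (hW : IsCondExpOperator W) {x y : E} (h : x ≤ y) : W x ≤ W y :=
  map_mono_of_nonneg hW.nonneg h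

theorem map_sup_eq (hW : IsCondExpOperator W) {f g : E} (hf : W f = f) (hg : W g = g) :
    W (f ⊔ g) = f ⊔ g :=
  hW.mem_range.1 (hW.sup_mem f (hW.mem_range.2 hf) g (hW.mem_range.2 hg))

theorem map_inf_eq (hW : IsCondExpOperator W) {f g : E} (hf : W f = f) (hg : W g = g) :
    W (f ⊓ g) = f ⊓ g := by
  have h : f ⊓ g = f + g - f ⊔ g := by rw [← inf_add_sup f g, add_sub_cancel_right]
  rw [h, map_sub, map_add, hf, hg, hW.map_sup_eq hf hg]

theorem map_posPart_eq (hW : IsCondExpOperator W) {f : E} (hf : W f = f) : W f⁺ = f⁺ :=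
  hW.map_sup_eq hf (map_zero W)

/-- The range of a conditional expectation operator is closed under directed infima. -/
theorem map_eq_of_isGLB (hW : IsCondExpOperator W) {s : Set E} (hne : s.Nonempty)
    (hs : DirectedOn (· ≥ ·) s) (hfix : ∀ x ∈ s, W x = x) {a : E} (ha : IsGLB s a) : W a = a := by
  -- Translating by `a` gives a family decreasing to `0`. Then `a - W a` is a lower bound of its
  -- image, while `W a ≤ a` needs only monotonicity.
  have h := hW.orderContinuous ((fun x => x - a) '' s) (hne.image _) ?_ ⟨?_, fun b hb => ?_⟩
  · refine le_antisymm (ha.2 fun x hx => ?_) ?_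
    · rw [← hfix x hx]
      exact hW.mono (ha.1 hx)
    · refine sub_nonpos.1 (h.2 ?_)
      rintro _ ⟨_, ⟨x, hx, rfl⟩, rfl⟩
      change a - W a ≤ W (x - a)
      rw [map_sub, hfix x hx]
      exact sub_le_sub_right (ha.1 hx) _
  · rintro _ ⟨x, hx, rfl⟩ _ ⟨y, hy, rfl⟩
    obtain ⟨z, hz, hzx, hzy⟩ := hs x hx y hy
    exact ⟨_, ⟨z, hz, rfl⟩, sub_le_sub_right hzx a, sub_le_sub_right hzy a⟩
  · rintro _ ⟨x, hx, rfl⟩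
    exact sub_nonneg.2 (ha.1 hx)
  · have : b + a ≤ a := ha.2 fun x hx => le_sub_iff_add_le.1 (hb ⟨x, hx, rfl⟩)
    simpa using this

end IsCondExpOperator

end CondExpRange

-- Spectral projections and Freudenthal approximation.

section SpectralProjections

variable {E : Type*} [AddCommGroup E] [ConditionallyCompleteLattice E] [IsOrderedAddMonoid E]
  [Module ℝ E] [IsOrderedModule ℝ E]

/-- The projection onto the band generated by `f⁺`. -/
noncomputable def posProj (f : E) : E →ₗ[ℝ] E := bandProj f⁺ (posPart_nonneg f)

theorem isBandProjection_posProj (f : E) : IsBandProjection (posProj f) :=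
  isBandProjection_bandProj _

theorem posProj_apply_self (f : E) : posProj f f = f⁺ := by
  have h1 : bandPart f⁺ f⁺ = f⁺ := by
    refine le_antisymm (bandPart_le_self _ _) ?_
    have := inf_smul_le_bandPart f⁺ f⁺ 1
    simpa using this
  have h2 : bandPart f⁺ f⁻ = 0 := by
    refine le_antisymm (bandPart_le fun c => ?_) (bandPart_nonneg (negPart_nonneg f))
    have hc : (0 : ℝ) ≤ c := c.2
    -- Both entries are enlarged to the same multiple `1 + c` of a disjoint pair.
    calc f⁻ ⊓ (c : ℝ) • f⁺ ≤ ((1 + c : ℝ) • f⁻) ⊓ ((1 + c : ℝ) • f⁺) := by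
          refine inf_le_inf ?_ ?_
          · rw [add_smul, one_smul]
            exact le_add_of_nonneg_right (smul_nonneg hc (negPart_nonneg f))
          · rw [add_smul, one_smul]
            exact le_add_of_nonneg_left (posPart_nonneg f)
      _ = 0 := by
          rw [← smul_inf_of_nonneg (by positivity), inf_comm, posPart_inf_negPart_eq_zero,
            smul_zero]
  change bandPart f⁺ f⁺ - bandPart f⁺ f⁻ = f⁺
  rw [h1, h2, sub_zero]

/-- `e - posProj f e` is the infimum of the elements `e - e ⊓ c • f⁺`, which lie in the range of `W`
and decrease as `c` grows. -/
theorem posProj_mem_bandProjections {e f : E} {W : E →ₗ[ℝ] E} (hW : IsCondExpOperator W)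
    (he : 0 ≤ e) (hWe : W e = e) (hf : W f = f) : posProj f ∈ bandProjections e W := by
  refine ⟨isBandProjection_posProj f, hW.mem_range.2 ?_⟩
  have key : W (e - bandPart f⁺ e) = e - bandPart f⁺ e := by
    refine hW.map_eq_of_isGLB (s := Set.range fun c : NNReal => e - e ⊓ (c : ℝ) • f⁺)
      (Set.range_nonempty _) ?_ ?_ ⟨?_, fun b hb => ?_⟩
    · rintro _ ⟨c, rfl⟩ _ ⟨d, rfl⟩
      have hm : ∀ a : NNReal, a ≤ max c d →
          e - e ⊓ ((max c d : NNReal) : ℝ) • f⁺ ≤ e - e ⊓ (a : ℝ) • f⁺ := fun a ha =>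
        sub_le_sub_left (inf_le_inf_left _ (smul_le_smul_of_nonneg_right
          (NNReal.coe_le_coe.2 ha) (posPart_nonneg f))) _
      exact ⟨_, ⟨max c d, rfl⟩, hm c (le_max_left _ _), hm d (le_max_right _ _)⟩
    · rintro _ ⟨c, rfl⟩
      rw [map_sub, hWe, hW.map_inf_eq hWe]
      rw [map_smul, hW.map_posPart_eq hf]
    · rintro _ ⟨c, rfl⟩
      exact sub_le_sub_left (inf_smul_le_bandPart _ _ c) _
    · rw [le_sub_comm]
      exact bandPart_le fun c => le_sub_comm.1 (hb ⟨c, rfl⟩)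
  rw [map_sub, hWe, sub_right_inj] at key
  rw [posProj, bandProj_apply _ he, key]

theorem bandPart_mono_left {u v : E} (h : u ≤ v) (f : E) : bandPart u f ≤ bandPart v f :=
  bandPart_le fun c => (inf_le_inf_left _ (smul_le_smul_of_nonneg_left h c.2)).trans
    (inf_smul_le_bandPart v f c)

theorem posProj_apply_posProj {x y : E} (h : x ≤ y) (f : E) :
    posProj x (posProj y f) = posProj x f := by
  rw [(isBandProjection_posProj x).commute (isBandProjection_posProj y)]
  refine eq_of_eq_on_cone (A := posProj y ∘ₗ posProj x) (fun f hf => ?_) f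
  refine (isBandProjection_posProj y).eq_self_of_le
    ((isBandProjection_posProj x).nonneg f hf) (y := f) ?_
  rw [posProj, posProj, bandProj_apply _ hf, bandProj_apply _ hf]
  exact bandPart_mono_left (posPart_mono h) f

theorem smul_posProj_le {e x : E} (hx : 0 ≤ x) (t : ℝ) : t • posProj (x - t • e) e ≤ x := by
  have h := posPart_nonneg (x - t • e)
  rw [← posProj_apply_self, map_sub, map_smul] at h
  exact (sub_nonneg.1 h).trans ((isBandProjection_posProj _).le_self x hx)

/-- On the band of `(x - t • e)⁺`, raising the threshold by `δ` adds at most `δ • e`; on its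
complement `x` is already below `t • e`. -/
theorem inf_add_smul_le {e : E} (he : 0 ≤ e) (x : E) (t : ℝ) {δ : ℝ} (hδ : 0 ≤ δ) :
    x ⊓ (t + δ) • e ≤ x ⊓ t • e + δ • posProj (x - t • e) e := by
  set D := posProj (x - t • e) with hD
  have hDp : IsBandProjection D := isBandProjection_posProj _
  have h1 : D (x ⊓ (t + δ) • e) ≤ D (x ⊓ t • e) + δ • D e := by
    rw [← map_smul, ← map_add]
    refine hDp.mono ?_
    rw [inf_add, add_smul]
    exact inf_le_inf_right _ (le_add_of_nonneg_right (smul_nonneg hδ he))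
  set C := LinearMap.id - D with hC
  have h2 : C (x ⊓ (t + δ) • e) ≤ C (x ⊓ t • e) := by
    have hle : C x ≤ C (t • e) := by
      have : C (x - t • e) ≤ 0 := by
        rw [hC, LinearMap.sub_apply, LinearMap.id_apply, hD, posProj_apply_self, sub_nonpos]
        exact le_posPart _
      rwa [map_sub, sub_nonpos] at this
    rw [hDp.compl.map_inf x (t • e), inf_eq_left.2 hle]
    exact hDp.compl.mono inf_le_left
  have hs : ∀ y, y = D y + C y := fun y => by simp [hC]
  calc x ⊓ (t + δ) • e = D (x ⊓ (t + δ) • e) + C (x ⊓ (t + δ) • e) := hs _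
    _ ≤ (D (x ⊓ t • e) + δ • D e) + C (x ⊓ t • e) := add_le_add h1 h2
    _ = (D (x ⊓ t • e) + C (x ⊓ t • e)) + δ • D e := by abel
    _ = x ⊓ t • e + δ • D e := by rw [← hs]

/-- If `D 0 ≥ D 1 ≥ …` are band projections with `(k + 1) δ • D k y ≤ u` for all `k`, then
`∑ k < m, δ • D k y ≤ u`. -/
theorem smul_sum_le_of_antitone {D : ℕ → E →ₗ[ℝ] E} (hD : ∀ k, IsBandProjection (D k))
    (hanti : ∀ k m, k ≤ m → ∀ f, D m (D k f) = D m f) {δ : ℝ} {y u : E}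
    (hu : 0 ≤ u) (h : ∀ k : ℕ, (((k : ℝ) + 1) * δ) • D k y ≤ u) (m : ℕ) :
    δ • ∑ k ∈ Finset.range m, D k y ≤ u := by
  induction m with
  | zero => simpa using hu
  | succ m ih =>
    -- On `D m` all earlier projections act as `D m`, so the sum becomes `m + 1` equal terms. Off `D
    -- m` the last term vanishes and the induction hypothesis applies.
    have h1 : D m (δ • ∑ k ∈ Finset.range (m + 1), D k y) ≤ D m u := by
      have h2 : D m (δ • ∑ k ∈ Finset.range (m + 1), D k y) =
          D m ((((m : ℝ) + 1) * δ) • D m y) := by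
        rw [map_smul, map_sum, map_smul, (hD m).idem, Finset.sum_congr rfl fun k hk =>
          hanti k m (Nat.lt_succ_iff.1 (Finset.mem_range.1 hk)) y, Finset.sum_const,
          Finset.card_range, ← Nat.cast_smul_eq_nsmul ℝ, smul_smul, mul_comm]
        push_cast
        rfl
      rw [h2]
      exact (hD m).mono (h m)
    have h3 : (LinearMap.id - D m : E →ₗ[ℝ] E) (δ • ∑ k ∈ Finset.range (m + 1), D k y) ≤
        (LinearMap.id - D m : E →ₗ[ℝ] E) u := by
      have h4 : (LinearMap.id - D m : E →ₗ[ℝ] E) (δ • ∑ k ∈ Finset.range (m + 1), D k y) =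
          (LinearMap.id - D m : E →ₗ[ℝ] E) (δ • ∑ k ∈ Finset.range m, D k y) := by
        rw [Finset.sum_range_succ, smul_add, map_add, map_smul _ δ (D m y)]
        simp [(hD m).idem]
      rw [h4]
      exact (hD m).compl.mono ih
    have h5 := add_le_add h1 h3
    rwa [LinearMap.sub_apply, LinearMap.sub_apply, LinearMap.id_apply, LinearMap.id_apply,
      add_sub_cancel, add_sub_cancel] at h5

/-- The `n`-th simple approximation (in the sense of Freudenthal's theorem) of multiplication
by an element `0 ≤ x ≤ e`. -/
noncomputable def simpleApprox (e x : E) (n : ℕ) : E →ₗ[ℝ] E :=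
  ((n : ℝ) + 1)⁻¹ • ∑ k ∈ Finset.range (n + 1), posProj (x - (((k : ℝ) + 1) * ((n : ℝ) + 1)⁻¹) • e)

theorem simpleApprox_apply (e x : E) (n : ℕ) (y : E) :
    simpleApprox e x n y = ((n : ℝ) + 1)⁻¹ • ∑ k ∈ Finset.range (n + 1),
      posProj (x - (((k : ℝ) + 1) * ((n : ℝ) + 1)⁻¹) • e) y := by
  simp [simpleApprox]

/-- The bound `u` is left free: it is `x` when `y = e`, and the product `posMul e x y` in general.
-/
theorem simpleApprox_apply_le {e x y u : E} (he : 0 ≤ e) (hu : 0 ≤ u) (n : ℕ)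
    (h : ∀ t : ℝ, 0 ≤ t → t • posProj (x - t • e) y ≤ u) : simpleApprox e x n y ≤ u := by
  rw [simpleApprox_apply]
  have hn : (0 : ℝ) ≤ ((n : ℝ) + 1)⁻¹ := by positivity
  refine smul_sum_le_of_antitone (D := fun k =>
    posProj (x - (((k : ℝ) + 1) * ((n : ℝ) + 1)⁻¹) • e))
    (fun k => isBandProjection_posProj _) (fun k m hkm f => ?_) hu (fun k => ?_) _
  · refine posProj_apply_posProj (sub_le_sub_left (smul_le_smul_of_nonneg_right ?_ he) _) f
    have : (k : ℝ) ≤ m := Nat.cast_le.2 hkm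
    gcongr
  · exact h _ (by positivity)

theorem simpleApprox_unit_le {e x : E} (he : 0 ≤ e) (hx : 0 ≤ x) (n : ℕ) :
    simpleApprox e x n e ≤ x :=
  simpleApprox_apply_le he hx n fun t _ => smul_posProj_le hx t

theorem simpleApprox_nonneg (e x : E) (n : ℕ) (f : E) (hf : 0 ≤ f) :
    0 ≤ simpleApprox e x n f := by
  rw [simpleApprox_apply]
  exact smul_nonneg (by positivity)
    (Finset.sum_nonneg fun k _ => (isBandProjection_posProj _).nonneg f hf)

theorem simpleApprox_le_self (e x : E) (n : ℕ) (f : E) (hf : 0 ≤ f) :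
    simpleApprox e x n f ≤ f := by
  rw [simpleApprox_apply]
  have h : ∑ k ∈ Finset.range (n + 1), posProj (x - (((k : ℝ) + 1) * ((n : ℝ) + 1)⁻¹) • e) f ≤
      ((n : ℝ) + 1) • f := by
    refine (Finset.sum_le_card_nsmul _ _ f fun k _ =>
      (isBandProjection_posProj _).le_self f hf).trans_eq ?_
    rw [Finset.card_range, ← Nat.cast_smul_eq_nsmul ℝ]
    push_cast
    rfl
  have h' := smul_le_smul_of_nonneg_left h (a := ((n : ℝ) + 1)⁻¹) (by positivity)
  rwa [smul_smul, inv_mul_cancel₀ (by positivity), one_smul] at h'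

theorem isPosSeqContinuous_simpleApprox (e x : E) (n : ℕ) :
    IsPosSeqContinuous (simpleApprox e x n) :=
  .of_le_id (simpleApprox_nonneg e x n) (simpleApprox_le_self e x n)

theorem le_simpleApprox_unit_add {e x : E} (he : 0 ≤ e) (hxe : x ≤ e) (n : ℕ) :
    x ≤ simpleApprox e x n e + ((n : ℝ) + 1)⁻¹ • e := by
  set δ : ℝ := ((n : ℝ) + 1)⁻¹ with hδ
  have hδ0 : 0 ≤ δ := by positivity
  -- The extra `δ • e` pays for the lowest layer `x ⊓ δ • e`, so `m` terms reach height `(m + 1) *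
  -- δ`. At `m = n + 1` this height exceeds `1` and the truncation is `x` itself.
  have key : ∀ m : ℕ, x ⊓ (((m : ℝ) + 1) * δ) • e ≤
      δ • ∑ k ∈ Finset.range m, posProj (x - (((k : ℝ) + 1) * δ) • e) e + δ • e := by
    intro m
    induction m with
    | zero => simp
    | succ m ih =>
      have h := inf_add_smul_le he x (((m : ℝ) + 1) * δ) hδ0
      rw [Finset.sum_range_succ, smul_add, add_right_comm]
      refine le_trans (le_of_eq ?_) (h.trans (add_le_add_left ih _))
      congr 2
      push_cast
      ring
  have h := key (n + 1)
  rw [simpleApprox_apply]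
  refine le_trans (le_inf le_rfl (hxe.trans ?_)) h
  have h1 : (1 : ℝ) ≤ (((n + 1 : ℕ) : ℝ) + 1) * δ := by
    have h2 : ((n : ℝ) + 1) * δ = 1 := mul_inv_cancel₀ (by positivity)
    push_cast
    linarith
  have := smul_le_smul_of_nonneg_right h1 he
  rwa [one_smul] at this

end SpectralProjections

end RieszMixing

namespace RieszMixing

-- Comparing operators on components of the weak unit.

section Comparison

variable {E : Type*} [AddCommGroup E] [ConditionallyCompleteLattice E] [IsOrderedAddMonoid E]
  [Module ℝ E] [IsOrderedModule ℝ E] {e : E} {W : E →ₗ[ℝ] E}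

theorem bandPart_weakOrderUnit (he : IsWeakOrderUnit e) (f : E) : bandPart e f = f := by
  have h := he.2 (f - bandPart e f) (by
    rw [abs_of_nonneg (sub_nonneg.2 (bandPart_le_self e f)), sub_bandPart_inf he.1])
  exact (sub_eq_zero.1 h).symm

/-- A regular order continuous operator that is nonpositive at all truncations `f ⊓ n e` is
nonpositive at `f`. -/
theorem IsRegSeqContinuous.nonpos_of_truncations {A : E →ₗ[ℝ] E} (hA : IsRegSeqContinuous A)
    (he : IsWeakOrderUnit e) {f : E} (h : ∀ n : ℕ, A (f ⊓ (n : ℝ) • e) ≤ 0) : A f ≤ 0 := by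
  obtain ⟨B, C, hB, hC, rfl⟩ := hA
  -- These remainders decrease to `0` since `e` is a weak order unit. From `B (f ⊓ n e) ≤ C (f ⊓ n
  -- e) ≤ C f` it follows that `B f - C f` lies below `B` of each remainder.
  refine hB.cont (fun n : ℕ => f - f ⊓ (n : ℝ) • e) (fun m n hmn => ?_)
    (fun n => sub_nonneg.2 inf_le_left) (fun b hb => ?_) _ fun n => ?_
  · exact sub_le_sub_left (inf_le_inf_left _ (smul_le_smul_of_nonneg_right
      (Nat.cast_le.2 hmn) he.1)) _
  · have h1 : bandPart e f ≤ f - b := bandPart_le fun c => by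
      obtain ⟨n, hn⟩ := exists_nat_ge (c : ℝ)
      exact (inf_le_inf_left _ (smul_le_smul_of_nonneg_right hn he.1)).trans (le_sub_comm.1 (hb n))
    rw [bandPart_weakOrderUnit he] at h1
    simpa using h1
  · have h1 : B (f ⊓ (n : ℝ) • e) ≤ C f :=
      (sub_nonpos.1 (h n)).trans (hC.mono inf_le_left)
    rw [map_sub, LinearMap.sub_apply]
    exact sub_le_sub_left h1 _

/-- A regular order continuous operator that is nonpositive at the components of `e` in the range of
a conditional expectation operator `W` is nonpositive on the positive cone of that range. -/
theorem IsRegSeqContinuous.nonpos_of_components {A : E →ₗ[ℝ] E} (hA : IsRegSeqContinuous A)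
    (he : IsWeakOrderUnit e) (hW : IsCondExpOperator W) (hWe : W e = e)
    (h : ∀ P ∈ bandProjections e W, A (P e) ≤ 0) {f : E} (hf : 0 ≤ f) (hWf : W f = f) :
    A f ≤ 0 := by
  -- The simple approximant of `x` at `e` combines components in the range of `W`, where `B ≤ C`. It
  -- lies below `x` and misses it by at most `(n + 1)⁻¹ • e`, whence the error `B e`.
  have bounded : ∀ x, 0 ≤ x → x ≤ e → W x = x → A x ≤ 0 := by
    obtain ⟨B, C, hB, hC, rfl⟩ := hA
    intro x hx hxe hWx
    rw [LinearMap.sub_apply, sub_nonpos]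
    refine le_of_forall_le_add_inv_smul (z := B e) fun n => ?_
    have h1 := hB.mono (le_simpleApprox_unit_add he.1 hxe n)
    rw [map_add, map_smul] at h1
    refine h1.trans (add_le_add_left ?_ _)
    refine le_trans ?_ (hC.mono (simpleApprox_unit_le he.1 hx n))
    rw [simpleApprox_apply, map_smul, map_smul, map_sum, map_sum]
    refine smul_le_smul_of_nonneg_left (Finset.sum_le_sum fun k _ => ?_) (by positivity)
    refine sub_nonpos.1 (h _ (posProj_mem_bandProjections hW he.1 hWe ?_))
    rw [map_sub, map_smul, hWe, hWx]
  refine hA.nonpos_of_truncations he fun n => ?_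
  cases n with
  | zero => simp [inf_eq_right.2 hf]
  | succ n =>
    set c : ℝ := ((n + 1 : ℕ) : ℝ) with hc
    have hc0 : 0 < c := by rw [hc]; positivity
    have h1 := bounded (c⁻¹ • (f ⊓ c • e))
      (smul_nonneg (inv_nonneg.2 hc0.le) (le_inf hf (smul_nonneg hc0.le he.1))) ?_ ?_
    · rw [map_smul] at h1
      have h2 := smul_le_smul_of_nonneg_left h1 hc0.le
      rwa [smul_smul, mul_inv_cancel₀ hc0.ne', one_smul, smul_zero] at h2
    · have h2 := smul_le_smul_of_nonneg_left (inf_le_right : f ⊓ c • e ≤ c • e)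
        (inv_nonneg.2 hc0.le)
      rwa [smul_smul c⁻¹, inv_mul_cancel₀ hc0.ne', one_smul] at h2
    · rw [map_smul, hW.map_inf_eq hWf]
      rw [map_smul, hWe]

theorem le_of_le_components {A B : E →ₗ[ℝ] E} (hA : IsRegSeqContinuous A)
    (hB : IsRegSeqContinuous B)
    (he : IsWeakOrderUnit e) (hW : IsCondExpOperator W) (hWe : W e = e)
    (h : ∀ P ∈ bandProjections e W, A (P e) ≤ B (P e)) {f : E} (hf : 0 ≤ f) (hWf : W f = f) :
    A f ≤ B f :=
  sub_nonpos.1 ((hA.sub hB).nonpos_of_components he hW hWe (fun P hP => sub_nonpos.2 (h P hP))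
    hf hWf)

theorem compl_mem_bandProjections (hWe : W e = e) {P : E →ₗ[ℝ] E}
    (hP : P ∈ bandProjections e W) : LinearMap.id - P ∈ bandProjections e W :=
  ⟨hP.1.compl, sub_mem ⟨e, hWe⟩ hP.2⟩

/-- A conditional expectation operator commutes with the band projections `P` for which `P e`
lies in its range. -/
theorem IsCondExpOperator.commute (hW : IsCondExpOperator W) (he : IsWeakOrderUnit e)
    (hWe : W e = e) {P : E →ₗ[ℝ] E} (hP : P ∈ bandProjections e W) (f : E) :
    W (P f) = P (W f) := by
  -- `W` preserves the range of `P`: for a truncation, `W (P (f ⊓ n e)) ≤ n P e` because `W` fixes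
  -- `P e`. Using this for both `P` and its complement yields commutation.
  have solid : ∀ P ∈ bandProjections e W, ∀ f, 0 ≤ f → P (W (P f)) = W (P f) := by
    intro P hP f hf
    have hPW := hP.1
    refine le_antisymm (hPW.le_self _ (hW.nonneg _ (hPW.nonneg _ hf))) (sub_nonpos.1 ?_)
    have hreg : IsRegSeqContinuous ((LinearMap.id - P) ∘ₗ W ∘ₗ P) :=
      hPW.compl.isPosSeqContinuous.isReg.comp
        (hW.isPosSeqContinuous.isReg.comp hPW.isPosSeqContinuous.isReg)
    refine hreg.nonpos_of_truncations he fun n => le_of_eq ?_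
    have hne : (0 : E) ≤ f ⊓ (n : ℝ) • e := le_inf hf (smul_nonneg n.cast_nonneg he.1)
    have h1 : W (P (f ⊓ (n : ℝ) • e)) ≤ P ((n : ℝ) • e) := by
      refine (hW.mono (hPW.mono inf_le_right)).trans_eq ?_
      rw [map_smul, map_smul, hW.mem_range.1 hP.2]
    have h2 := hPW.eq_self_of_le (hW.nonneg _ (hPW.nonneg _ hne)) h1
    simp [h2]
  refine eq_of_eq_on_cone (A := W ∘ₗ P) (B := P ∘ₗ W) (fun f hf => ?_) f
  have h1 := solid P hP f hf
  have h2 := solid _ (compl_mem_bandProjections hWe hP) f hf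
  simp only [LinearMap.sub_apply, LinearMap.id_apply, map_sub, h1] at h2
  simp only [LinearMap.comp_apply]
  have h3 : P (W f) = W (P f) := by simpa using h2
  exact h3.symm

end Comparison

-- Products as operators, and the averaging property.

section Multiplication

variable {E : Type*} [AddCommGroup E] [ConditionallyCompleteLattice E] [IsOrderedAddMonoid E]
  [Module ℝ E] [IsOrderedModule ℝ E] {e : E} {T : E →ₗ[ℝ] E}

theorem simpleApprox_le_posMul {x y : E} (he : IsWeakOrderUnit e) (hx : 0 ≤ x) (hxe : x ≤ e)
    (hy : 0 ≤ y) (n : ℕ) : simpleApprox e x n y ≤ posMul e x y := by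
  obtain ⟨hl, h0, -⟩ := isLUB_posMul he hx hxe hy
  exact simpleApprox_apply_le he.1 h0 n fun t ht =>
    hl.1 ⟨t, _, ht, isBandProjection_posProj _, smul_posProj_le hx t, rfl⟩

/-- If `A` is a positive order continuous operator that commutes at `e` with the band projections
of `𝓑(T)`, then on the range of `T` it is close to the simple approximations of multiplication
by `A e`. -/
theorem simpleApprox_approximates (he : IsWeakOrderUnit e) (hT : IsCondExpOperator T)
    (hTe : T e = e) {A : E →ₗ[ℝ] E} (hA : IsPosSeqContinuous A)
    (hAD : ∀ D ∈ bandProjections e T, A (D e) = D (A e)) (hAe : A e ≤ e)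
    {y : E} (hy : 0 ≤ y) (hTy : T y = y) (n : ℕ) :
    simpleApprox e (A e) n y ≤ A y ∧
      A y ≤ simpleApprox e (A e) n y + ((n : ℝ) + 1)⁻¹ • y := by
  have hx := hA.nonneg e he.1
  have hZ := isPosSeqContinuous_simpleApprox e (A e) n
  have hcomm : ∀ D ∈ bandProjections e T,
      simpleApprox e (A e) n (D e) = D (simpleApprox e (A e) n e) := fun D hD => by
    simp only [simpleApprox_apply, map_smul, map_sum]
    exact congrArg _ (Finset.sum_congr rfl fun k _ => (isBandProjection_posProj _).commute hD.1 e)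
  constructor
  · refine le_of_le_components hZ.isReg hA.isReg he hT hTe (fun D hD => ?_) hy hTy
    rw [hcomm D hD, hAD D hD]
    exact hD.1.mono (simpleApprox_unit_le he.1 hx n)
  · have hid : IsPosSeqContinuous (LinearMap.id : E →ₗ[ℝ] E) :=
      .of_le_id (fun _ h => h) (fun _ _ => le_rfl)
    refine le_of_le_components hA.isReg
      (hZ.add (hid.smul (by positivity : (0 : ℝ) ≤ ((n : ℝ) + 1)⁻¹))).isReg he hT hTe
      (fun D hD => ?_) hy hTy
    simp only [LinearMap.add_apply, LinearMap.smul_apply, LinearMap.id_apply]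
    rw [hcomm D hD, hAD D hD, ← map_smul, ← map_add]
    exact hD.1.mono (le_simpleApprox_unit_add he.1 hAe n)

/-- Such an operator is multiplication by `A e` on the range of `T`. -/
theorem posMul_eq_apply (he : IsWeakOrderUnit e) (hT : IsCondExpOperator T)
    (hTe : T e = e) {A : E →ₗ[ℝ] E} (hA : IsPosSeqContinuous A)
    (hAD : ∀ D ∈ bandProjections e T, A (D e) = D (A e)) (hAe : A e ≤ e)
    {y : E} (hy : 0 ≤ y) (hTy : T y = y) : posMul e (A e) y = A y := by
  have hx := hA.nonneg e he.1
  apply le_antisymm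
  · refine (isLUB_posMul he hx hAe hy).1.2 ?_
    rintro _ ⟨t, B, ht, hB, htB, rfl⟩
    refine le_of_le_components (A := t • B) (hB.isPosSeqContinuous.smul ht).isReg hA.isReg he hT
      hTe (fun D hD => ?_) hy hTy
    rw [hAD D hD, LinearMap.smul_apply, hB.commute hD.1, ← map_smul]
    exact hD.1.mono htB
  · refine le_of_forall_le_add_inv_smul (z := y) fun n => ?_
    exact (simpleApprox_approximates he hT hTe hA hAD hAe hy hTy n).2.trans
      (add_le_add_left (simpleApprox_le_posMul he hx hAe hy n) _)

theorem IsCondExpOperator.comp_bandProjection_commute (he : IsWeakOrderUnit e)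
    (hT : IsCondExpOperator T) (hTe : T e = e) {P D : E →ₗ[ℝ] E} (hP : IsBandProjection P)
    (hD : D ∈ bandProjections e T) (f : E) : T (P (D f)) = D (T (P f)) := by
  rw [hP.commute hD.1, hT.commute he hTe hD]

theorem IsCondExpOperator.apply_bandProjection_le (he : IsWeakOrderUnit e)
    (hT : IsCondExpOperator T) (hTe : T e = e) {P : E →ₗ[ℝ] E} (hP : IsBandProjection P) :
    T (P e) ≤ e :=
  (hT.mono (hP.le_self e he.1)).trans_eq hTe

/-- The averaging property: `T ∘ P` commutes at `e` with the projections in `𝓑(T)`, so on positive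
elements of the range of `T` it is multiplication by its value at `e`. -/
theorem posMul_condExp (he : IsWeakOrderUnit e) (hT : IsCondExpOperator T)
    (hTe : T e = e) {P Q : E →ₗ[ℝ] E} (hP : IsBandProjection P) (hQ : IsBandProjection Q) :
    posMul e (T (P e)) (T (Q e)) = T (P (T (Q e))) :=
  posMul_eq_apply he hT hTe (A := T ∘ₗ P) (hT.isPosSeqContinuous.comp hP.isPosSeqContinuous)
    (fun _ hD => hT.comp_bandProjection_commute he hTe hP hD e)
    (hT.apply_bandProjection_le he hTe hP) (hT.nonneg _ (hQ.nonneg _ he.1)) (hT.idem _)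

/-- Commutativity of the product of `T (P e)` and `T (Q e)`. Both sides are within `(n + 1)⁻¹ • T (Q
e)` of the same approximant: the left by operator comparison, the right because `T ∘ Q` commutes at
`e` with the projections that form it. -/
theorem condExp_bandProjection_comm (he : IsWeakOrderUnit e) (hT : IsCondExpOperator T)
    (hTe : T e = e) {P Q : E →ₗ[ℝ] E} (hP : IsBandProjection P) (hQ : IsBandProjection Q) :
    T (P (T (Q e))) = T (Q (T (P e))) := by
  have hx0 : 0 ≤ T (P e) := hT.nonneg _ (hP.nonneg _ he.1)
  have hy0 : 0 ≤ T (Q e) := hT.nonneg _ (hQ.nonneg _ he.1)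
  have hxe := hT.apply_bandProjection_le he hTe hP
  have h1 := simpleApprox_approximates he hT hTe (A := T ∘ₗ P)
    (hT.isPosSeqContinuous.comp hP.isPosSeqContinuous)
    (fun _ hD => hT.comp_bandProjection_commute he hTe hP hD e) hxe hy0 (hT.idem _)
  simp only [LinearMap.comp_apply] at h1
  have hTQ := hT.isPosSeqContinuous.comp hQ.isPosSeqContinuous
  have h2 : ∀ n, T (Q (simpleApprox e (T (P e)) n e)) =
      simpleApprox e (T (P e)) n (T (Q e)) := fun n => by
    simp only [simpleApprox_apply, map_smul, map_sum]
    refine congrArg _ (Finset.sum_congr rfl fun k _ => ?_)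
    refine hT.comp_bandProjection_commute he hTe hQ
      (posProj_mem_bandProjections hT he.1 hTe ?_) e
    rw [map_sub, map_smul, hTe, hT.idem]
  have h3 : ∀ n, simpleApprox e (T (P e)) n (T (Q e)) ≤ T (Q (T (P e))) := fun n => by
    rw [← h2]
    exact hTQ.mono (simpleApprox_unit_le he.1 hx0 n)
  have h4 : ∀ n : ℕ, T (Q (T (P e))) ≤
      simpleApprox e (T (P e)) n (T (Q e)) + ((n : ℝ) + 1)⁻¹ • T (Q e) := fun n => by
    rw [← h2]
    have := hTQ.mono (le_simpleApprox_unit_add he.1 hxe n)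
    simpa only [LinearMap.comp_apply, map_add, map_smul] using this
  exact le_antisymm
    (le_of_forall_le_add_inv_smul fun n => (h1 n).2.trans (add_le_add_left (h3 n) _))
    (le_of_forall_le_add_inv_smul fun n => (h4 n).trans (add_le_add_left (h1 n).1 _))

end Multiplication

end RieszMixing

namespace RieszMixing

-- The covariance operator and the mixing inequality.

section MixingInequality

variable {E : Type*} [AddCommGroup E] [ConditionallyCompleteLattice E] [IsOrderedAddMonoid E]
  [Module ℝ E] [IsOrderedModule ℝ E] {e : E} {T U V : E →ₗ[ℝ] E}

/-- The infimum `‖f‖_{T,∞}` belongs to the range of `T`. -/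
theorem apply_normInfty (hT : IsCondExpOperator T) {f : E} (hf : f ∈ LInfty T) :
    T (normInfty T f) = normInfty T f := by
  have hf' := hf
  obtain ⟨h, hh, h0, hfh⟩ := hf'
  refine hT.map_eq_of_isGLB (s := {g | g ∈ LinearMap.range T ∧ 0 ≤ g ∧ |f| ≤ g})
    ⟨h, hh, h0, hfh⟩ ?_ (fun x hx => hT.mem_range.1 hx.1) (isGLB_normInfty hf)
  rintro x ⟨hx, hx0, hfx⟩ y ⟨hy, hy0, hfy⟩
  exact ⟨x ⊓ y, ⟨hT.mem_range.2 (hT.map_inf_eq (hT.mem_range.1 hx) (hT.mem_range.1 hy)),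
    le_inf hx0 hy0, le_inf hfx hfy⟩, inf_le_left, inf_le_right⟩

theorem Compatible.apply_left (h : Compatible U T) (f : E) : T (U f) = T f :=
  LinearMap.congr_fun h.1 f

theorem Compatible.apply_right (h : Compatible U T) (f : E) : U (T f) = T f :=
  LinearMap.congr_fun h.2 f

theorem Compatible.apply_eq (h : Compatible U T) {f : E} (hf : T f = f) : U f = f := by
  rw [← hf, h.apply_right]

theorem Compatible.bandProjections_subset (h : Compatible U T) :
    bandProjections e T ⊆ bandProjections e U := by
  rintro P ⟨hP, f, hf⟩
  exact ⟨hP, T f, by rw [h.apply_right, hf]⟩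

/-- The symmetry `2P - I` at a projection `P`. -/
def reflection (P : E →ₗ[ℝ] E) : E →ₗ[ℝ] E := P - (LinearMap.id - P)

theorem reflection_apply (P : E →ₗ[ℝ] E) (f : E) : reflection P f = P f - (f - P f) := rfl

theorem IsBandProjection.reflection_isReg {P : E →ₗ[ℝ] E} (hP : IsBandProjection P) :
    IsRegSeqContinuous (reflection P) :=
  hP.isPosSeqContinuous.isReg.sub hP.compl.isPosSeqContinuous.isReg

theorem reflection_posProj (f : E) : reflection (posProj f) f = |f| := by
  rw [reflection_apply, posProj_apply_self, ← posPart_add_negPart f]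
  have h : f = f⁺ - f⁻ := (posPart_sub_negPart f).symm
  have h' : f⁺ - f = f⁻ := by nth_rewrite 2 [h]; abel
  rw [← h']
  abel

theorem reflection_commute {P A : E →ₗ[ℝ] E} (h : ∀ f, A (P f) = P (A f)) (f : E) :
    A (reflection P f) = reflection P (A f) := by
  simp only [reflection_apply, map_sub, h]

/-- The operator `f ↦ T (S (V f)) - T (S (T f))`. -/
def covarianceOp (T V S : E →ₗ[ℝ] E) : E →ₗ[ℝ] E := T ∘ₗ S ∘ₗ V - T ∘ₗ S ∘ₗ T

theorem covarianceOp_apply (S : E →ₗ[ℝ] E) (f : E) :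
    covarianceOp T V S f = T (S (V f)) - T (S (T f)) := rfl

theorem isReg_covarianceOp (hT : IsCondExpOperator T) (hV : IsCondExpOperator V) {S : E →ₗ[ℝ] E}
    (hS : IsRegSeqContinuous S) : IsRegSeqContinuous (covarianceOp T V S) :=
  have hT' := hT.isPosSeqContinuous.isReg
  (hT'.comp (hS.comp hV.isPosSeqContinuous.isReg)).sub (hT'.comp (hS.comp hT'))

/-- `T(S T B e) = T(B T S e)` for the symmetry `S` at a band projection. -/
theorem condExp_reflection_comm (he : IsWeakOrderUnit e) (hT : IsCondExpOperator T)
    (hTe : T e = e) {P B : E →ₗ[ℝ] E} (hP : IsBandProjection P) (hB : IsBandProjection B) :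
    T (reflection P (T (B e))) = T (B (T (reflection P e))) := by
  simp only [reflection_apply, map_sub, hTe, hT.idem, condExp_bandProjection_comm he hT hTe hP hB]

/-- On a component `B e` in the range of `V`, the covariance operator after a commuting band
projection `C` is integration against `V(Se) - T(Se)`. -/
theorem covarianceOp_component (he : IsWeakOrderUnit e) (hT : IsCondExpOperator T)
    (hTe : T e = e) (hV : IsCondExpOperator V) (hVT : Compatible V T)
    {P B : E →ₗ[ℝ] E} (hP : IsBandProjection P) (hB : B ∈ bandProjections e V) :
    covarianceOp T V (reflection P) (B e) =
      T (B (V (reflection P e) - T (reflection P e))) := by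
  have hVe : V e = e := hVT.apply_eq hTe
  rw [covarianceOp_apply, hV.commute he hVe hB, hVe, condExp_reflection_comm he hT hTe hP hB.1,
    map_sub, map_sub, ← hV.commute he hVe hB, hVT.apply_left,
    reflection_commute (fun f => hB.1.commute hP f)]

theorem comp_mem_bandProjections (he : IsWeakOrderUnit e) (hV : IsCondExpOperator V)
    (hVe : V e = e) {P Q : E →ₗ[ℝ] E} (hP : P ∈ bandProjections e V)
    (hQ : Q ∈ bandProjections e V) : P ∘ₗ Q ∈ bandProjections e V := by
  refine ⟨hP.1.comp hQ.1, hV.mem_range.2 ?_⟩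
  rw [LinearMap.comp_apply, hV.commute he hVe hP, hV.mem_range.1 hQ.2]

/-- The covariance operator is maximised over `|f| ≤ N` in the range of `V` by the symmetry at the
positive part of `V(Se) - T(Se)`. -/
theorem covarianceOp_le_reflection (he : IsWeakOrderUnit e) (hT : IsCondExpOperator T)
    (hTe : T e = e) (hV : IsCondExpOperator V) (hVT : Compatible V T)
    {P : E →ₗ[ℝ] E} (hP : IsBandProjection P) {f N : E} (hf : V f = f) (hN : V N = N)
    (hfN : |f| ≤ N) :
    covarianceOp T V (reflection P) f ≤ covarianceOp T V (reflection P)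
      (reflection (posProj (V (reflection P e) - T (reflection P e))) N) := by
  have hVe : V e = e := hVT.apply_eq hTe
  set w := V (reflection P e) - T (reflection P e) with hw
  have hVw : V w = w := by rw [hw, map_sub, hV.idem, hVT.apply_right]
  set Q := posProj w with hQ
  have hQV : Q ∈ bandProjections e V := posProj_mem_bandProjections hV he.1 hVe hVw
  have hQw : Q w = w⁺ := posProj_apply_self w
  have hφ := isReg_covarianceOp hT hV hP.reflection_isReg
  set φ := covarianceOp T V (reflection P) with hφd
  -- For `B` in `𝓑(V)`, `φ (Q (B e)) = T (B w⁺) ≥ 0`, and on the complement of `Q` the value is `T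
  -- (B (w - w⁺)) ≤ 0`.
  have hpos : ∀ h, 0 ≤ h → V h = h → 0 ≤ φ (Q h) := fun h h0 hVh => by
    refine neg_nonpos.1 ((hφ.comp hQV.1.isPosSeqContinuous.isReg).neg.nonpos_of_components
      he hV hVe (fun B hB => ?_) h0 hVh)
    have h1 := covarianceOp_component he hT hTe hV hVT hP
      (comp_mem_bandProjections he hV hVe hB hQV)
    rw [← hw, LinearMap.comp_apply, LinearMap.comp_apply, hQw, hB.1.commute hQV.1] at h1
    rw [LinearMap.neg_apply, LinearMap.comp_apply, neg_nonpos, hφd, h1]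
    exact hT.nonneg _ (hB.1.nonneg _ (posPart_nonneg w))
  have hneg : ∀ h, 0 ≤ h → V h = h → φ (h - Q h) ≤ 0 := fun h h0 hVh => by
    refine (hφ.comp hQV.1.compl.isPosSeqContinuous.isReg).nonpos_of_components
      he hV hVe (fun B hB => ?_) h0 hVh
    have hC := compl_mem_bandProjections hVe hQV
    have h1 := covarianceOp_component he hT hTe hV hVT hP
      (comp_mem_bandProjections he hV hVe hB hC)
    rw [← hw, LinearMap.comp_apply, hB.1.commute hC.1, LinearMap.comp_apply] at h1
    rw [LinearMap.comp_apply, hφd, h1, LinearMap.sub_apply, LinearMap.id_apply, hQw]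
    refine (hT.mono (hB.1.mono (sub_nonpos.2 (le_posPart w)))).trans_eq ?_
    rw [map_zero, map_zero]
  -- With `N - f` and `N + f` positive, `φ ((I - Q)(N + f)) ≤ 0 ≤ φ (Q (N - f))`; the terms `φ (Q
  -- f)` cancel and the claim remains.
  have h1 := hpos (N - f) (sub_nonneg.2 ((le_abs_self f).trans hfN)) (by rw [map_sub, hN, hf])
  have h2 := hneg (N + f) (by
    rw [← sub_neg_eq_add, sub_nonneg]
    exact (neg_le_abs f).trans hfN) (by rw [map_add, hN, hf])
  have h3 := h2.trans h1
  have h4 : φ (N + f - Q (N + f)) = φ f - φ (Q f) + φ (N - Q N) := by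
    simp only [map_sub, map_add]; abel
  have h5 : φ (Q (N - f)) = φ (Q N) - φ (Q f) := by simp only [map_sub]
  rw [h4, h5] at h3
  rw [reflection_apply, map_sub φ (Q N), le_sub_iff_add_le]
  have h6 := add_le_add_left h3 (φ (Q f))
  simpa [sub_add_eq_add_sub] using h6

/-- For `P ∈ 𝓑(U)` and `Q ∈ 𝓑(V)` the covariance of the symmetries is at most `4 α_T(U,V)`. -/
theorem covarianceOp_reflection_unit_le (he : IsWeakOrderUnit e) (hT : IsCondExpOperator T)
    (hTe : T e = e) (hV : IsCondExpOperator V) (hVT : Compatible V T) {P Q : E →ₗ[ℝ] E}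
    (hP : P ∈ bandProjections e U) (hQ : Q ∈ bandProjections e V) :
    covarianceOp T V (reflection P) (reflection Q e) ≤ (4 : ℝ) • strongMixing e T U V := by
  have hVe : V e = e := hVT.apply_eq hTe
  have hα : T (P (Q e)) - T (P (T (Q e))) ≤ strongMixing e T U V := by
    refine (le_abs_self _).trans ((isLUB_strongMixing he hT hTe).1.1 ⟨P, hP, Q, hQ, ?_⟩)
    rw [unitMul_of_nonneg he (hT.nonneg _ (hP.1.nonneg _ he.1))
      (hT.apply_bandProjection_le he hTe hP.1) (hT.nonneg _ (hQ.1.nonneg _ he.1)),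
      posMul_condExp he hT hTe hP.1 hQ.1]
  have h := smul_le_smul_of_nonneg_left hα (by norm_num : (0 : ℝ) ≤ 4)
  refine le_trans (le_of_eq ?_) h
  -- Since `T (Q e)` and `T (T (Q e))` agree, the identity parts of the symmetries drop out; the
  -- constant 4 is the product of the two factors 2 in `2P - I` and `2Q - I`.
  rw [covarianceOp_apply]
  simp only [reflection_apply, map_sub, hVe, hTe, hT.idem, hV.mem_range.1 hQ.2]
  module

/-- If `A` is regular, order continuous and commutes at `e` with the band projections of `𝓑(T)`,
then `A e ≤ c x` with `0 ≤ x ≤ e` implies `A y ≤ c (x · y)` for `0 ≤ y` in the range of `T`. -/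
theorem IsRegSeqContinuous.apply_le_smul_posMul (he : IsWeakOrderUnit e)
    (hT : IsCondExpOperator T) (hTe : T e = e) {A : E →ₗ[ℝ] E} (hA : IsRegSeqContinuous A)
    (hAD : ∀ D ∈ bandProjections e T, A (D e) = D (A e)) {c : ℝ} (hc : 0 ≤ c) {x : E}
    (hx : 0 ≤ x) (hxe : x ≤ e) (hAe : A e ≤ c • x) {y : E} (hy : 0 ≤ y) (hTy : T y = y) :
    A y ≤ c • posMul e x y := by
  refine le_of_forall_le_add_inv_smul (z := c • y) fun n => ?_
  have hid : IsPosSeqContinuous (LinearMap.id : E →ₗ[ℝ] E) :=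
    .of_le_id (fun _ h => h) (fun _ _ => le_rfl)
  have hZ := ((isPosSeqContinuous_simpleApprox e x n).add
    (hid.smul (by positivity : (0 : ℝ) ≤ ((n : ℝ) + 1)⁻¹))).smul hc
  have h1 := le_of_le_components hA hZ.isReg he hT hTe (fun D hD => ?_) hy hTy
  · refine h1.trans ?_
    simp only [LinearMap.add_apply, LinearMap.smul_apply, LinearMap.id_apply]
    rw [smul_comm _ c y, ← smul_add]
    exact smul_le_smul_of_nonneg_left
      (add_le_add_left (simpleApprox_le_posMul he hx hxe hy n) _) hc
  · have hcomm : simpleApprox e x n (D e) = D (simpleApprox e x n e) := by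
      simp only [simpleApprox_apply, map_smul, map_sum]
      exact congrArg _ (Finset.sum_congr rfl fun k _ =>
        (isBandProjection_posProj _).commute hD.1 e)
    simp only [LinearMap.add_apply, LinearMap.smul_apply, LinearMap.id_apply]
    rw [hcomm, hAD D hD, ← map_smul, ← map_add, ← map_smul]
    exact hD.1.mono (hAe.trans
      (smul_le_smul_of_nonneg_left (le_simpleApprox_unit_add he.1 hxe n) hc))

theorem norm1_le_smul_posMul (he : IsWeakOrderUnit e) (hT : IsCondExpOperator T) (hTe : T e = e)
    (hU : IsCondExpOperator U) (hUT : Compatible U T)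
    (hV : IsCondExpOperator V) (hVT : Compatible V T) {g : E} (hg : g ∈ LInfty T) :
    norm1 T (U (V g) - T g) ≤
      (4 : ℝ) • posMul e (strongMixing e T U V) (normInfty T g) := by
  have hUe : U e = e := hUT.apply_eq hTe
  have hVe : V e = e := hVT.apply_eq hTe
  obtain ⟨-, hα0, hαe⟩ := isLUB_strongMixing (U := U) (V := V) he hT hTe
  set N := normInfty T g with hNd
  have hTN : T N = N := apply_normInfty hT hg
  have hVN : V N = N := hVT.apply_eq hTN
  have hgN : |g| ≤ N := (isGLB_normInfty hg).2 fun _ h => h.2.2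
  have hN0 : 0 ≤ N := (abs_nonneg g).trans hgN
  set f := U (V g) - T g with hf
  have hUf : U f = f := by rw [hf, map_sub, hU.idem, hUT.apply_right]
  set P := posProj f with hPd
  have hP : P ∈ bandProjections e U := posProj_mem_bandProjections hU he.1 hUe hUf
  have h1 : norm1 T f = covarianceOp T V (reflection P) (V g) := by
    rw [norm1, ← reflection_posProj, ← hPd, hf, map_sub, map_sub,
      ← reflection_commute (hU.commute he hUe hP), hUT.apply_left, covarianceOp_apply, hV.idem,
      hVT.apply_left]
  have hVg : |V g| ≤ N := by
    rw [← hVN]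
    refine sup_le (hV.mono ((le_abs_self g).trans hgN)) ?_
    rw [← map_neg]
    exact hV.mono ((neg_le_abs g).trans hgN)
  rw [h1]
  refine (covarianceOp_le_reflection he hT hTe hV hVT hP.1 (hV.idem g) hVN hVg).trans ?_
  set w := V (reflection P e) - T (reflection P e) with hw
  have hVw : V w = w := by rw [hw, map_sub, hV.idem, hVT.apply_right]
  set Q := posProj w
  have hQ : Q ∈ bandProjections e V := posProj_mem_bandProjections hV he.1 hVe hVw
  refine IsRegSeqContinuous.apply_le_smul_posMul he hT hTe
    (A := covarianceOp T V (reflection P) ∘ₗ reflection Q)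
    ((isReg_covarianceOp hT hV hP.1.reflection_isReg).comp hQ.1.reflection_isReg)
    (fun D hD => ?_) (by norm_num) hα0 hαe
    (covarianceOp_reflection_unit_le he hT hTe hV hVT hP hQ) hN0 hTN
  have hDP : ∀ f, D (reflection P f) = reflection P (D f) :=
    reflection_commute fun f => hD.1.commute hP.1 f
  have hDQ : ∀ f, D (reflection Q f) = reflection Q (D f) :=
    reflection_commute fun f => hD.1.commute hQ.1 f
  have hDT := hT.commute he hTe hD
  have hDV := hV.commute he hVe (hVT.bandProjections_subset hD)
  -- `D` commutes with every factor: with `T`, with `V` because `𝓑(T) ⊆ 𝓑(V)`, and with both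
  -- symmetries.
  simp only [LinearMap.comp_apply, covarianceOp_apply, map_sub]
  rw [← hDQ, hDV, hDT, ← hDP, ← hDP, hDT, hDT]

end MixingInequality

end RieszMixing

theorem corollary4p9 {E Eu : Type*}
    [AddCommGroup E] [ConditionallyCompleteLattice E] [IsOrderedAddMonoid E]
    [Module ℝ E] [IsOrderedModule ℝ E]
    [AddCommGroup Eu] [Lattice Eu] [IsOrderedAddMonoid Eu]
    [Module ℝ Eu] [IsOrderedModule ℝ Eu]
    (ι : E →ₗ[ℝ] Eu) (hι : IsUniversalCompletion ι)
    (e : E) (he : IsWeakOrderUnit e)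
    (T U V : E →ₗ[ℝ] E)
    (hT : IsCondExpOperator T) (hTe : T e = e)
    (hE : IsTUniversallyComplete T ι)
    (hU : IsCondExpOperator U) (hUT : Compatible U T)
    (hV : IsCondExpOperator V) (hVT : Compatible V T)
    (g : E) (hg : g ∈ LInfty T) :
    norm1 T (U (V g) - T g) ≤
      (4 : ℝ) • unitMul e (strongMixing e T U V) (normInfty T g) := by
  obtain ⟨-, hα0, hαe⟩ := isLUB_strongMixing (U := U) (V := V) he hT hTe
  have hN0 : 0 ≤ normInfty T g := (isGLB_normInfty hg).2 fun _ h => h.2.1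
  rw [unitMul_of_nonneg he hα0 hαe hN0]
  exact norm1_le_smul_posMul he hT hTe hU hUT hV hVT hg
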